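/- Let $H$ be a finite-dimensional complex Hilbert space and let $V\in B(H\otimes H)$ be a multiplicative unitary, that is, a unitary satisfying the pentagon equation $V_{12}V_{13}V_{23}=V_{23}V_{12}$ on $H\otimes H\otimes H$. Let $$S=\{(\omega\otimes\mathrm{id})(V):\omega\in B(H)^*\},\qquad \widehat S=\{(\mathrm{id}\otimes\rho)(V):\rho\in B(H)^*\}$$ be the associated concrete Hopf C*-subalgebras of $B(H)$, where $S$ carries the coproduct $\delta(x)=V(x\otimes 1)V^*\in S\otimes S$, and where $S$ and $\widehat S$ are in duality through the non-degenerate pairing $\beta\big((\omega\otimes\mathrm{id})(V),(\mathrm{id}\otimes\rho)(V)\big)=(\omega\otimes\rho)(V)$. Let $u\in B(H)$ be a unitary such that $\alpha(x)=uxu^*$ defines a Hopf *-automorphism of $S$, that is, a *-automorphism of $S$ with $\delta\circ\alpha=(\alpha\otimes\alpha)\circ\delta$. Suppose that its action $\widehat\alpha$ on the dual $\widehat S$, determined by $\beta(x,\widehat\alpha(y))=\beta(\alpha(x),y)$ for $x\in S$, $y\in\widehat S$, is inner, that is, $\widehat\alpha(y)=gyg^{-1}$ for some invertible $g\in\widehat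 S$. Then there is a unitary $\widehat u\in\widehat S$ such that $\widehat u\otimes u$ commutes with $V$. -/

import Mathlib

open scoped TensorProduct

noncomputable section

/-! ### Slice maps and legs of operators on tensor products -/

section Slices

variable {E F : Type*} [AddCommGroup E] [Module ℂ E] [FiniteDimensional ℂ E]
  [AddCommGroup F] [Module ℂ F] [FiniteDimensional ℂ F]

/-- The slice map `ω ⊗ id : B(E ⊗ F) → B(F)` of a linear functional `ω` on `B(E)`. -/
def sliceFst (ω : Module.Dual ℂ (Module.End ℂ E)) :
    Module.End ℂ (E ⊗[ℂ] F) →ₗ[ℂ] Module.End ℂ F :=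
  (TensorProduct.lid ℂ (Module.End ℂ F)).toLinearMap ∘ₗ
    LinearMap.rTensor (Module.End ℂ F) ω ∘ₗ (homTensorHomEquiv ℂ E F E F).symm.toLinearMap

/-- The slice map `id ⊗ ω : B(E ⊗ F) → B(E)` of a linear functional `ω` on `B(F)`. -/
def sliceSnd (ω : Module.Dual ℂ (Module.End ℂ F)) :
    Module.End ℂ (E ⊗[ℂ] F) →ₗ[ℂ] Module.End ℂ E :=
  (TensorProduct.rid ℂ (Module.End ℂ E)).toLinearMap ∘ₗ
    LinearMap.lTensor (Module.End ℂ E) ω ∘ₗ (homTensorHomEquiv ℂ E F E F).symm.toLinearMap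

theorem homTensorHomEquiv_symm_map (a : Module.End ℂ E) (b : Module.End ℂ F) :
    (homTensorHomEquiv ℂ E F E F).symm (TensorProduct.map a b) = a ⊗ₜ b := by
  rw [LinearEquiv.symm_apply_eq, homTensorHomEquiv_apply]; rfl

theorem sliceFst_map (ω : Module.Dual ℂ (Module.End ℂ E)) (a : Module.End ℂ E)
    (b : Module.End ℂ F) : sliceFst ω (TensorProduct.map a b) = ω a • b := by
  simp [sliceFst, homTensorHomEquiv_symm_map]

theorem sliceSnd_map (ω : Module.Dual ℂ (Module.End ℂ F)) (a : Module.End ℂ E)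
    (b : Module.End ℂ F) : sliceSnd ω (TensorProduct.map a b) = ω b • a := by
  simp [sliceSnd, homTensorHomEquiv_symm_map]

theorem endTensor_induction {P : Module.End ℂ (E ⊗[ℂ] F) → Prop}
    (h0 : P 0) (hm : ∀ a b, P (TensorProduct.map a b)) (ha : ∀ X Y, P X → P Y → P (X + Y))
    (X : Module.End ℂ (E ⊗[ℂ] F)) : P X := by
  obtain ⟨t, rfl⟩ := (homTensorHomEquiv ℂ E F E F).surjective X
  induction t using TensorProduct.induction_on with
  | zero => simpa using h0
  | tmul a b =>
    rw [← homTensorHomEquiv_symm_map, LinearEquiv.apply_symm_apply]; exact hm a b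
  | add s t hs ht => rw [map_add]; exact ha _ _ hs ht

theorem eq_sum_map_sliceFst {ι : Type*} [Fintype ι] (b : Module.Basis ι ℂ (Module.End ℂ E))
    (X : Module.End ℂ (E ⊗[ℂ] F)) :
    X = ∑ i, TensorProduct.map (b i) (sliceFst (b.coord i) X) := by
  induction X using endTensor_induction with
  | h0 => simp
  | hm x y =>
    have h := congrArg (fun z => TensorProduct.mapBilinear (.id ℂ) E F E F z y) (b.sum_repr x)
    simp only [map_sum, map_smul, LinearMap.sum_apply, LinearMap.smul_apply,
      TensorProduct.mapBilinear_apply] at h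
    simp [sliceFst_map, TensorProduct.map_smul_right, h]
  | ha X Y hX hY =>
    conv_lhs => rw [hX, hY]
    simp [TensorProduct.map_add_right, Finset.sum_add_distrib]

theorem eq_sum_map_sliceSnd {ι : Type*} [Fintype ι] (b : Module.Basis ι ℂ (Module.End ℂ F))
    (X : Module.End ℂ (E ⊗[ℂ] F)) :
    X = ∑ i, TensorProduct.map (sliceSnd (b.coord i) X) (b i) := by
  induction X using endTensor_induction with
  | h0 => simp
  | hm x y =>
    have h := congrArg (fun z => TensorProduct.mapBilinear (.id ℂ) E F E F x z) (b.sum_repr y)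
    simp only [map_sum, map_smul, TensorProduct.mapBilinear_apply] at h
    simp [sliceSnd_map, TensorProduct.map_smul_left, h]
  | ha X Y hX hY =>
    conv_lhs => rw [hX, hY]
    simp [TensorProduct.map_add_left, Finset.sum_add_distrib]

theorem apply_sliceFst_eq (ω : Module.Dual ℂ (Module.End ℂ E)) (ρ : Module.Dual ℂ (Module.End ℂ F))
    (X : Module.End ℂ (E ⊗[ℂ] F)) : ρ (sliceFst ω X) = ω (sliceSnd ρ X) := by
  induction X using endTensor_induction with
  | h0 => simp
  | hm x y => simp [sliceFst_map, sliceSnd_map, mul_comm]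
  | ha X Y hX hY => simp [hX, hY]

end Slices

section Legs

variable {H : Type*} [AddCommGroup H] [Module ℂ H]

/-- `X₁₂ = X ⊗ 1` on `H ⊗ H ⊗ H`. -/
def leg12 (X : Module.End ℂ (H ⊗[ℂ] H)) : Module.End ℂ (H ⊗[ℂ] (H ⊗[ℂ] H)) :=
  (TensorProduct.assoc ℂ H H H).toLinearMap ∘ₗ LinearMap.rTensor H X ∘ₗ
    (TensorProduct.assoc ℂ H H H).symm.toLinearMap

/-- `X₂₃ = 1 ⊗ X` on `H ⊗ H ⊗ H`. -/
def leg23 (X : Module.End ℂ (H ⊗[ℂ] H)) : Module.End ℂ (H ⊗[ℂ] (H ⊗[ℂ] H)) :=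
  LinearMap.lTensor H X

/-- `X₁₃ = (1 ⊗ Σ) X₁₂ (1 ⊗ Σ)` on `H ⊗ H ⊗ H`, where `Σ` is the flip of `H ⊗ H`. -/
def leg13 (X : Module.End ℂ (H ⊗[ℂ] H)) : Module.End ℂ (H ⊗[ℂ] (H ⊗[ℂ] H)) :=
  LinearMap.lTensor H (TensorProduct.comm ℂ H H).toLinearMap ∘ₗ leg12 X ∘ₗ
    LinearMap.lTensor H (TensorProduct.comm ℂ H H).toLinearMap

theorem leg12_add (X Y : Module.End ℂ (H ⊗[ℂ] H)) : leg12 (X + Y) = leg12 X + leg12 Y := by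
  simp [leg12, LinearMap.rTensor_add, LinearMap.add_comp, LinearMap.comp_add]

theorem leg23_add (X Y : Module.End ℂ (H ⊗[ℂ] H)) : leg23 (X + Y) = leg23 X + leg23 Y := by
  simp [leg23, LinearMap.lTensor_add]

theorem leg13_add (X Y : Module.End ℂ (H ⊗[ℂ] H)) : leg13 (X + Y) = leg13 X + leg13 Y := by
  simp [leg13, leg12_add, LinearMap.add_comp, LinearMap.comp_add]

theorem leg12_zero : leg12 (0 : Module.End ℂ (H ⊗[ℂ] H)) = 0 := by simp [leg12]

theorem leg23_zero : leg23 (0 : Module.End ℂ (H ⊗[ℂ] H)) = 0 := by simp [leg23]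

theorem leg13_zero : leg13 (0 : Module.End ℂ (H ⊗[ℂ] H)) = 0 := by simp [leg13, leg12_zero]

theorem leg12_one : leg12 (1 : Module.End ℂ (H ⊗[ℂ] H)) = 1 := by
  refine LinearMap.ext fun x => ?_
  simp [leg12, Module.End.one_eq_id]

theorem leg23_one : leg23 (1 : Module.End ℂ (H ⊗[ℂ] H)) = 1 := by
  simp [leg23, Module.End.one_eq_id]

theorem leg12_mul (X Y : Module.End ℂ (H ⊗[ℂ] H)) : leg12 (X * Y) = leg12 X * leg12 Y := by
  refine LinearMap.ext fun x => ?_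
  simp [leg12, Module.End.mul_eq_comp, LinearMap.rTensor_comp]

theorem leg23_mul (X Y : Module.End ℂ (H ⊗[ℂ] H)) : leg23 (X * Y) = leg23 X * leg23 Y := by
  simp [leg23, Module.End.mul_eq_comp, LinearMap.lTensor_comp]

theorem leg12_map (a b : Module.End ℂ H) :
    leg12 (TensorProduct.map a b) = TensorProduct.map a (TensorProduct.map b 1) := by
  refine TensorProduct.ext_threefold' fun x y z => ?_
  simp [leg12]

theorem leg23_map (a b : Module.End ℂ H) :
    leg23 (TensorProduct.map a b) = TensorProduct.map 1 (TensorProduct.map a b) := rfl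

theorem leg13_map (a b : Module.End ℂ H) :
    leg13 (TensorProduct.map a b) = TensorProduct.map a (TensorProduct.map 1 b) := by
  refine TensorProduct.ext_threefold' fun x y z => ?_
  simp [leg13, leg12_map]

variable [FiniteDimensional ℂ H]

theorem slice_leg13_mul_leg23 (ω ρ : Module.Dual ℂ (Module.End ℂ H))
    (X Y : Module.End ℂ (H ⊗[ℂ] H)) :
    sliceFst ρ (sliceFst ω (leg13 X * leg23 Y)) = sliceFst ω X * sliceFst ρ Y := by
  induction X using endTensor_induction with
  | h0 => simp [leg13_zero]
  | ha X X' hX hX' => simp [leg13_add, add_mul, hX, hX']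
  | hm a b =>
    induction Y using endTensor_induction with
    | h0 => simp [leg23_zero]
    | ha Y Y' hY hY' => simp [leg23_add, mul_add, hY, hY']
    | hm c d =>
      rw [leg13_map, leg23_map, ← TensorProduct.map_mul, ← TensorProduct.map_mul]
      simp [sliceFst_map, smul_smul, mul_comm]

theorem slice_leg12_mul_leg13 (ω ρ : Module.Dual ℂ (Module.End ℂ H))
    (X Y : Module.End ℂ (H ⊗[ℂ] H)) :
    sliceSnd (ρ ∘ₗ sliceFst ω) (leg12 X * leg13 Y) = sliceSnd ω X * sliceSnd ρ Y := by
  induction X using endTensor_induction with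
  | h0 => simp [leg12_zero]
  | ha X X' hX hX' => simp [leg12_add, add_mul, hX, hX']
  | hm a b =>
    induction Y using endTensor_induction with
    | h0 => simp [leg13_zero]
    | ha Y Y' hY hY' => simp [leg13_add, mul_add, hY, hY']
    | hm c d =>
      rw [leg12_map, leg13_map, ← TensorProduct.map_mul, ← TensorProduct.map_mul]
      simp [sliceSnd_map, sliceFst_map, smul_smul, mul_comm]

theorem slice_leg12_leg23_leg12 (ω ρ : Module.Dual ℂ (Module.End ℂ H))
    (P X Q : Module.End ℂ (H ⊗[ℂ] H)) :
    sliceFst ρ (sliceFst ω (leg12 P * leg23 X * leg12 Q)) =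
      sliceFst (ρ ∘ₗ sliceFst ω ∘ₗ LinearMap.mulLeft ℂ P ∘ₗ LinearMap.mulRight ℂ Q ∘ₗ
        TensorProduct.mapBilinear (.id ℂ) H H H H 1) X := by
  induction X using endTensor_induction with
  | h0 => simp [leg23_zero]
  | ha X X' hX hX' => simp [leg23_add, mul_add, add_mul, hX, hX']
  | hm a b =>
    rw [sliceFst_map]
    induction P using endTensor_induction with
    | h0 => simp [leg12_zero]
    | ha P P' hP hP' => simp [leg12_add, add_mul, add_smul, hP, hP']
    | hm c d =>
      induction Q using endTensor_induction with
      | h0 => simp [leg12_zero]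
      | ha Q Q' hQ hQ' => simp [leg12_add, mul_add, add_smul, hQ, hQ']
      | hm e f =>
        rw [leg12_map, leg23_map, leg12_map]
        simp [← TensorProduct.map_mul, sliceFst_map, smul_smul, mul_assoc]

theorem slice_leg23_leg12_leg23 (ω : Module.Dual ℂ (Module.End ℂ (H ⊗[ℂ] H)))
    (P X Q : Module.End ℂ (H ⊗[ℂ] H)) :
    sliceSnd ω (leg23 P * leg12 X * leg23 Q) =
      sliceSnd (ω ∘ₗ LinearMap.mulLeft ℂ P ∘ₗ LinearMap.mulRight ℂ Q ∘ₗ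
        (TensorProduct.mapBilinear (.id ℂ) H H H H).flip 1) X := by
  induction X using endTensor_induction with
  | h0 => simp [leg12_zero]
  | ha X X' hX hX' => simp [leg12_add, mul_add, add_mul, hX, hX']
  | hm a b =>
    have h : leg23 P * leg12 (TensorProduct.map a b) * leg23 Q =
        TensorProduct.map a (P * TensorProduct.map b 1 * Q) := by
      rw [leg12_map]
      refine TensorProduct.ext_threefold' fun x y z => ?_
      simp [leg23]
    rw [h, sliceSnd_map, sliceSnd_map]
    simp [mul_assoc]

theorem sliceFst_leg23_leg12_leg23 (ω : Module.Dual ℂ (Module.End ℂ H))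
    (P X Q : Module.End ℂ (H ⊗[ℂ] H)) :
    sliceFst ω (leg23 P * leg12 X * leg23 Q) = P * TensorProduct.map (sliceFst ω X) 1 * Q := by
  induction X using endTensor_induction with
  | h0 => simp [leg12_zero]
  | ha X X' hX hX' => simp [leg12_add, mul_add, add_mul, hX, hX', TensorProduct.map_add_left]
  | hm a b =>
    have h : leg23 P * leg12 (TensorProduct.map a b) * leg23 Q =
        TensorProduct.map a (P * TensorProduct.map b 1 * Q) := by
      rw [leg12_map]
      refine TensorProduct.ext_threefold' fun x y z => ?_
      simp [leg23]
    rw [h, sliceFst_map, sliceFst_map]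
    simp [TensorProduct.map_smul_left]

end Legs

section Closure

theorem one_mem_and_inv_mem {R : Type*} [Ring R] [Algebra ℂ R] [FiniteDimensional ℂ R]
    (M : Submodule ℂ R) (hM : ∀ x ∈ M, ∀ y ∈ M, x * y ∈ M) {v w : R} (hv : v ∈ M)
    (hwv : w * v = 1) : 1 ∈ M ∧ w ∈ M := by
  let f : M →ₗ[ℂ] M := (LinearMap.mulLeft ℂ v).restrict fun x hx => hM v hv x hx
  have hf : Function.Injective f := by
    intro x y hxy
    have h : v * (x : R) = v * y := congrArg Subtype.val hxy
    apply Subtype.ext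
    calc (x : R) = w * (v * x) := by rw [← mul_assoc, hwv, one_mul]
      _ = w * (v * y) := by rw [h]
      _ = y := by rw [← mul_assoc, hwv, one_mul]
  have key : ∀ z ∈ M, w * z ∈ M := by
    intro z hz
    obtain ⟨x, hx⟩ := LinearMap.injective_iff_surjective.mp hf ⟨z, hz⟩
    have h : v * (x : R) = z := congrArg Subtype.val hx
    have h' : w * z = x := by rw [← h, ← mul_assoc, hwv, one_mul]
    rw [h']; exact x.2
  have h1 : (1 : R) ∈ M := hwv ▸ key v hv
  exact ⟨h1, by simpa using key 1 h1⟩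

variable {E F : Type*} [NormedAddCommGroup E] [InnerProductSpace ℂ E] [FiniteDimensional ℂ E]
  [NormedAddCommGroup F] [InnerProductSpace ℂ F] [FiniteDimensional ℂ F]

theorem conj_functional_exists {R : Type*} [Ring R] [StarRing R] [Algebra ℂ R] [StarModule ℂ R]
    (ω : Module.Dual ℂ R) : ∃ ρ : Module.Dual ℂ R, ∀ x, ρ x = star (ω (star x)) :=
  ⟨{ toFun := fun x => star (ω (star x))
     map_add' := by simp
     map_smul' := by simp }, fun _ => rfl⟩

theorem star_map_tensor (a : Module.End ℂ E) (b : Module.End ℂ F) :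
    star (TensorProduct.map a b : Module.End ℂ (E ⊗[ℂ] F)) =
      TensorProduct.map (star a) (star b) :=
  TensorProduct.adjoint_map a b

theorem exists_star_sliceFst (ω : Module.Dual ℂ (Module.End ℂ E)) :
    ∃ ρ : Module.Dual ℂ (Module.End ℂ E), ∀ X : Module.End ℂ (E ⊗[ℂ] F),
      star (sliceFst ω X) = sliceFst ρ (star X) := by
  obtain ⟨ρ, hρ⟩ := conj_functional_exists ω
  refine ⟨ρ, fun X => ?_⟩
  induction X using endTensor_induction with
  | h0 =>
    have h : star (0 : Module.End ℂ (E ⊗[ℂ] F)) = 0 :=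
      star_zero (Module.End ℂ (E ⊗[ℂ] F))
    rw [h]; simp
  | ha X Y hX hY =>
    have h : star (X + Y) = star X + star Y := star_add X Y
    rw [h]; simp [hX, hY]
  | hm a b => simp [star_map_tensor, sliceFst_map, hρ]

theorem exists_star_sliceSnd (ω : Module.Dual ℂ (Module.End ℂ F)) :
    ∃ ρ : Module.Dual ℂ (Module.End ℂ F), ∀ X : Module.End ℂ (E ⊗[ℂ] F),
      star (sliceSnd ω X) = sliceSnd ρ (star X) := by
  obtain ⟨ρ, hρ⟩ := conj_functional_exists ω
  refine ⟨ρ, fun X => ?_⟩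
  induction X using endTensor_induction with
  | h0 =>
    have h : star (0 : Module.End ℂ (E ⊗[ℂ] F)) = 0 :=
      star_zero (Module.End ℂ (E ⊗[ℂ] F))
    rw [h]; simp
  | ha X Y hX hY =>
    have h : star (X + Y) = star X + star Y := star_add X Y
    rw [h]; simp [hX, hY]
  | hm a b => simp [star_map_tensor, sliceSnd_map, hρ]

theorem exists_dual_one {R : Type*} [Ring R] [Algebra ℂ R] :
    ∃ ω : Module.Dual ℂ R, ω 1 • (1 : R) = 1 := by
  by_cases h : (1 : R) = 0
  · exact ⟨0, by simp [h]⟩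
  · obtain ⟨ω, hω⟩ := Module.Projective.exists_dual_ne_zero ℂ h
    exact ⟨(ω 1)⁻¹ • ω, by simp [hω]⟩

/-- If the slices `(ω ⊗ id)(V)` of the unitary `V` form a subspace `W` closed under products,
then `W` contains `1` and is closed under `*`. -/
theorem sliceFst_closed (W : Submodule ℂ (Module.End ℂ E))
    (hW : ∀ x ∈ W, ∀ y ∈ W, x * y ∈ W) (V : Module.End ℂ (E ⊗[ℂ] E)) (hV : star V * V = 1)
    (hVW : ∀ x, x ∈ W ↔ ∃ ω, sliceFst ω V = x) : 1 ∈ W ∧ ∀ x ∈ W, star x ∈ W := by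
  let M : Submodule ℂ (Module.End ℂ (E ⊗[ℂ] E)) := ⨅ ω, W.comap (sliceFst ω)
  have memM : ∀ X, X ∈ M ↔ ∀ ω, sliceFst ω X ∈ W := by simp [M]
  have hM : ∀ x ∈ M, ∀ y ∈ M, x * y ∈ M := by
    intro X hX Y hY
    rw [memM] at *
    intro ω
    let b := Module.finBasis ℂ (Module.End ℂ E)
    rw [eq_sum_map_sliceFst b X, eq_sum_map_sliceFst b Y, Finset.sum_mul_sum, map_sum]
    refine W.sum_mem fun i _ => ?_
    rw [map_sum]
    refine W.sum_mem fun j _ => ?_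
    rw [← TensorProduct.map_mul, sliceFst_map]
    exact W.smul_mem _ (hW _ (hX _) _ (hY _))
  obtain ⟨h1, hs⟩ := one_mem_and_inv_mem M hM ((memM V).2 fun ω => (hVW _).2 ⟨ω, rfl⟩) hV
  constructor
  · obtain ⟨ω, hω⟩ := exists_dual_one (R := Module.End ℂ E)
    have h := (memM 1).1 h1 ω
    rwa [← TensorProduct.map_one, sliceFst_map, hω] at h
  · intro x hx
    obtain ⟨ω, rfl⟩ := (hVW x).1 hx
    obtain ⟨ρ, hρ⟩ := exists_star_sliceFst (F := E) ω
    rw [hρ]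
    exact (memM _).1 hs ρ

/-- If the slices `(id ⊗ ω)(V)` of the unitary `V` form a subspace `W` closed under products,
then `W` contains `1` and is closed under `*`. -/
theorem sliceSnd_closed (W : Submodule ℂ (Module.End ℂ E))
    (hW : ∀ x ∈ W, ∀ y ∈ W, x * y ∈ W) (V : Module.End ℂ (E ⊗[ℂ] E)) (hV : star V * V = 1)
    (hVW : ∀ x, x ∈ W ↔ ∃ ω, sliceSnd ω V = x) : 1 ∈ W ∧ ∀ x ∈ W, star x ∈ W := by
  let M : Submodule ℂ (Module.End ℂ (E ⊗[ℂ] E)) := ⨅ ω, W.comap (sliceSnd ω)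
  have memM : ∀ X, X ∈ M ↔ ∀ ω, sliceSnd ω X ∈ W := by simp [M]
  have hM : ∀ x ∈ M, ∀ y ∈ M, x * y ∈ M := by
    intro X hX Y hY
    rw [memM] at *
    intro ω
    let b := Module.finBasis ℂ (Module.End ℂ E)
    rw [eq_sum_map_sliceSnd b X, eq_sum_map_sliceSnd b Y, Finset.sum_mul_sum, map_sum]
    refine W.sum_mem fun i _ => ?_
    rw [map_sum]
    refine W.sum_mem fun j _ => ?_
    rw [← TensorProduct.map_mul, sliceSnd_map]
    exact W.smul_mem _ (hW _ (hX _) _ (hY _))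
  obtain ⟨h1, hs⟩ := one_mem_and_inv_mem M hM ((memM V).2 fun ω => (hVW _).2 ⟨ω, rfl⟩) hV
  constructor
  · obtain ⟨ω, hω⟩ := exists_dual_one (R := Module.End ℂ E)
    have h := (memM 1).1 h1 ω
    rwa [← TensorProduct.map_one, sliceSnd_map, hω] at h
  · intro x hx
    obtain ⟨ω, rfl⟩ := (hVW x).1 hx
    obtain ⟨ρ, hρ⟩ := exists_star_sliceSnd (E := E) ω
    rw [hρ]
    exact (memM _).1 hs ρ

end Closure

/-! ### Multiplicative unitaries and their Hopf C*-algebras -/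

/-- A multiplicative unitary on the finite-dimensional Hilbert space `H`: a unitary operator on
`H ⊗ H` that satisfies the pentagon equation `V₁₂ V₁₃ V₂₃ = V₂₃ V₁₂`. -/
structure MultiplicativeUnitary (H : Type*) [NormedAddCommGroup H] [InnerProductSpace ℂ H]
    [FiniteDimensional ℂ H] where
  /-- the underlying operator -/
  op : Module.End ℂ (H ⊗[ℂ] H)
  mem_unitary : op ∈ unitary (Module.End ℂ (H ⊗[ℂ] H))
  pentagon : leg12 op * leg13 op * leg23 op = leg23 op * leg12 op

namespace MultiplicativeUnitary

variable {H : Type*} [NormedAddCommGroup H] [InnerProductSpace ℂ H] [FiniteDimensional ℂ H]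
  (V : MultiplicativeUnitary H)

theorem star_mul_op : star V.op * V.op = 1 := (Unitary.mem_iff.mp V.mem_unitary).1

theorem op_mul_star : V.op * star V.op = 1 := (Unitary.mem_iff.mp V.mem_unitary).2

/-- The map `ω ↦ (ω ⊗ id)(V)`. -/
def sliceFstMap : Module.Dual ℂ (Module.End ℂ H) →ₗ[ℂ] Module.End ℂ H where
  toFun ω := sliceFst ω V.op
  map_add' ω ρ := by simp [sliceFst, LinearMap.rTensor_add]
  map_smul' c ω := by simp [sliceFst, LinearMap.rTensor_smul]

/-- The map `ω ↦ (id ⊗ ω)(V)`. -/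
def sliceSndMap : Module.Dual ℂ (Module.End ℂ H) →ₗ[ℂ] Module.End ℂ H where
  toFun ω := sliceSnd ω V.op
  map_add' ω ρ := by simp [sliceSnd, LinearMap.lTensor_add]
  map_smul' c ω := by simp [sliceSnd, LinearMap.lTensor_smul]

theorem mul_mem_range_sliceFstMap (x : Module.End ℂ H)
    (hx : x ∈ LinearMap.range V.sliceFstMap) (y : Module.End ℂ H)
    (hy : y ∈ LinearMap.range V.sliceFstMap) :
    x * y ∈ LinearMap.range V.sliceFstMap := by
  obtain ⟨ω, rfl⟩ := hx
  obtain ⟨ρ, rfl⟩ := hy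
  have h : leg13 V.op * leg23 V.op = leg12 (star V.op) * leg23 V.op * leg12 V.op := by
    rw [mul_assoc, ← V.pentagon, mul_assoc (leg12 V.op), ← mul_assoc (leg12 (star V.op)),
      ← leg12_mul, V.star_mul_op, leg12_one, one_mul]
  exact ⟨_, (slice_leg12_leg23_leg12 ω ρ _ _ _).symm.trans
    (h ▸ slice_leg13_mul_leg23 ω ρ V.op V.op)⟩

theorem leg12_mul_leg13 :
    leg12 V.op * leg13 V.op = leg23 V.op * leg12 V.op * leg23 (star V.op) := by
  rw [← V.pentagon, mul_assoc _ (leg23 V.op), ← leg23_mul, V.op_mul_star, leg23_one, mul_one]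

theorem mul_mem_range_sliceSndMap (x : Module.End ℂ H)
    (hx : x ∈ LinearMap.range V.sliceSndMap) (y : Module.End ℂ H)
    (hy : y ∈ LinearMap.range V.sliceSndMap) :
    x * y ∈ LinearMap.range V.sliceSndMap := by
  obtain ⟨ω, rfl⟩ := hx
  obtain ⟨ρ, rfl⟩ := hy
  exact ⟨_, (slice_leg23_leg12_leg23 _ _ _ _).symm.trans
    (V.leg12_mul_leg13 ▸ slice_leg12_mul_leg13 ω ρ V.op V.op)⟩

/-- The concrete C*-algebra `S = {(ω ⊗ id)(V) : ω ∈ B(H)*} ⊆ B(H)`. -/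
def S : StarSubalgebra ℂ (Module.End ℂ H) where
  carrier := {x | ∃ ω : Module.Dual ℂ (Module.End ℂ H), sliceFst ω V.op = x}
  mul_mem' := fun {x y} hx hy => V.mul_mem_range_sliceFstMap x hx y hy
  add_mem' := fun {_ _} hx hy => (LinearMap.range V.sliceFstMap).add_mem hx hy
  algebraMap_mem' c := by
    rw [Algebra.algebraMap_eq_smul_one]
    exact (LinearMap.range V.sliceFstMap).smul_mem c
      (sliceFst_closed _ V.mul_mem_range_sliceFstMap V.op V.star_mul_op fun _ => Iff.rfl).1
  star_mem' := fun {x} hx =>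
    (sliceFst_closed _ V.mul_mem_range_sliceFstMap V.op V.star_mul_op fun _ => Iff.rfl).2 x hx

/-- The concrete dual C*-algebra `Ŝ = {(id ⊗ ω)(V) : ω ∈ B(H)*} ⊆ B(H)`. -/
def dualS : StarSubalgebra ℂ (Module.End ℂ H) where
  carrier := {x | ∃ ω : Module.Dual ℂ (Module.End ℂ H), sliceSnd ω V.op = x}
  mul_mem' := fun {x y} hx hy => V.mul_mem_range_sliceSndMap x hx y hy
  add_mem' := fun {_ _} hx hy => (LinearMap.range V.sliceSndMap).add_mem hx hy
  algebraMap_mem' c := by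
    rw [Algebra.algebraMap_eq_smul_one]
    exact (LinearMap.range V.sliceSndMap).smul_mem c
      (sliceSnd_closed _ V.mul_mem_range_sliceSndMap V.op V.star_mul_op fun _ => Iff.rfl).1
  star_mem' := fun {x} hx =>
    (sliceSnd_closed _ V.mul_mem_range_sliceSndMap V.op V.star_mul_op fun _ => Iff.rfl).2 x hx

/-! #### The coproduct of `S` -/

/-- The canonical embedding `S ⊗ S → B(H ⊗ H)`. -/
def tensorEmbedding : V.S ⊗[ℂ] V.S →ₗ[ℂ] Module.End ℂ (H ⊗[ℂ] H) :=
  (homTensorHomEquiv ℂ H H H H).toLinearMap ∘ₗ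
    TensorProduct.map V.S.subtype.toLinearMap V.S.subtype.toLinearMap

theorem tensorEmbedding_tmul (x y : V.S) :
    V.tensorEmbedding (x ⊗ₜ y) = TensorProduct.map (x : Module.End ℂ H) (y : Module.End ℂ H) := by
  rw [← LinearEquiv.apply_symm_apply (homTensorHomEquiv ℂ H H H H) (TensorProduct.map _ _),
    homTensorHomEquiv_symm_map]
  rfl

theorem tensorEmbedding_injective : Function.Injective V.tensorEmbedding := by
  refine (homTensorHomEquiv ℂ H H H H).injective.comp ?_
  exact TensorProduct.map_injective_of_flat_flat _ _ Subtype.val_injective Subtype.val_injective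

/-- The map `x ↦ V (x ⊗ 1) V*` from `S` to `B(H ⊗ H)`. -/
def coproductAux : V.S →ₗ[ℂ] Module.End ℂ (H ⊗[ℂ] H) :=
  LinearMap.mulLeft ℂ V.op ∘ₗ LinearMap.mulRight ℂ (star V.op) ∘ₗ
    (TensorProduct.mapBilinear (.id ℂ) H H H H).flip 1 ∘ₗ V.S.subtype.toLinearMap

theorem coproductAux_mem (x : V.S) : V.coproductAux x ∈ LinearMap.range V.tensorEmbedding := by
  obtain ⟨x, ω, rfl⟩ := x
  have h : V.coproductAux ⟨sliceFst ω V.op, ω, rfl⟩ =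
      sliceFst ω (leg12 V.op * leg13 V.op) := by
    rw [V.leg12_mul_leg13, sliceFst_leg23_leg12_leg23, mul_assoc]
    rfl
  rw [h]
  let b := Module.finBasis ℂ (Module.End ℂ H)
  let s : Fin _ → V.S := fun i => ⟨sliceFst (b.coord i) V.op, _, rfl⟩
  have hV : V.op = ∑ i, TensorProduct.map (b i) (s i : Module.End ℂ H) :=
    eq_sum_map_sliceFst b V.op
  have h12 : leg12 V.op =
      ∑ i, TensorProduct.map (b i) (TensorProduct.map (s i : Module.End ℂ H) 1) := by
    conv_lhs => rw [hV]
    rw [← AddMonoidHom.mk'_apply leg12 leg12_add, map_sum]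
    exact Finset.sum_congr rfl fun i _ => leg12_map _ _
  have h13 : leg13 V.op =
      ∑ i, TensorProduct.map (b i) (TensorProduct.map 1 (s i : Module.End ℂ H)) := by
    conv_lhs => rw [hV]
    rw [← AddMonoidHom.mk'_apply leg13 leg13_add, map_sum]
    exact Finset.sum_congr rfl fun i _ => leg13_map _ _
  rw [h12, h13, Finset.sum_mul_sum, map_sum]
  refine Submodule.sum_mem _ fun i _ => ?_
  rw [map_sum]
  refine Submodule.sum_mem _ fun j _ => ?_
  rw [← TensorProduct.map_mul, ← TensorProduct.map_mul, sliceFst_map, mul_one, one_mul]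
  exact Submodule.smul_mem _ _ ⟨s i ⊗ₜ s j, V.tensorEmbedding_tmul _ _⟩

/-- The coproduct `δ : S → S ⊗ S`, `δ(x) = V (x ⊗ 1) V*`. -/
def coproduct : V.S →ₗ[ℂ] V.S ⊗[ℂ] V.S :=
  (LinearEquiv.ofInjective V.tensorEmbedding V.tensorEmbedding_injective).symm.toLinearMap ∘ₗ
    V.coproductAux.codRestrict _ V.coproductAux_mem

/-- The defining property of the coproduct, inside `B(H ⊗ H)`. -/
theorem tensorEmbedding_coproduct (x : V.S) :
    V.tensorEmbedding (V.coproduct x) =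
      V.op * TensorProduct.map (x : Module.End ℂ H) 1 * star V.op := by
  rw [mul_assoc]
  exact congrArg Subtype.val
    ((LinearEquiv.ofInjective V.tensorEmbedding V.tensorEmbedding_injective).apply_symm_apply _)

/-- A *-automorphism `α` of `S` is a Hopf *-automorphism if `δ ∘ α = (α ⊗ α) ∘ δ`
(counit and antipode are determined by the coproduct, hence preserved). -/
def IsHopfAut (α : V.S ≃⋆ₐ[ℂ] V.S) : Prop :=
  ∀ x, V.coproduct (α x) =
    TensorProduct.map (α : V.S →ₗ[ℂ] V.S) (α : V.S →ₗ[ℂ] V.S) (V.coproduct x)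

/-! #### The duality between `S` and `Ŝ` -/

/-- Each element of `S` is a slice `(ω ⊗ id)(V)`; the functional `ω` is chosen linearly here. -/
theorem exists_sliceFst_section : ∃ r : V.S →ₗ[ℂ] Module.Dual ℂ (Module.End ℂ H),
    ∀ x : V.S, sliceFst (r x) V.op = x := by
  let f : Module.Dual ℂ (Module.End ℂ H) →ₗ[ℂ] V.S :=
    V.sliceFstMap.codRestrict (Subalgebra.toSubmodule V.S.toSubalgebra) fun ω => ⟨ω, rfl⟩
  have hf : LinearMap.range f = ⊤ := by
    rw [LinearMap.range_eq_top]
    rintro ⟨x, ω, rfl⟩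
    exact ⟨ω, rfl⟩
  obtain ⟨g, hg⟩ := f.exists_rightInverse_of_surjective hf
  exact ⟨g, fun x => congrArg Subtype.val (LinearMap.congr_fun hg x)⟩

/-- The pairing `β : S × Ŝ → ℂ`, `β((ω ⊗ id)(V), (id ⊗ ρ)(V)) = (ω ⊗ ρ)(V)`. It is evaluated as
`β((ω ⊗ id)(V), y) = ω(y)`, which does not depend on the choice of `ω`, see `pairing_slice`. -/
def pairing : V.S →ₗ[ℂ] V.dualS →ₗ[ℂ] ℂ :=
  (LinearMap.lcomp ℂ ℂ V.dualS.subtype.toLinearMap) ∘ₗ V.exists_sliceFst_section.choose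

/-- `β((ω ⊗ id)(V), (id ⊗ ρ)(V)) = ρ((ω ⊗ id)(V))`. -/
theorem pairing_slice (x : V.S) (ρ : Module.Dual ℂ (Module.End ℂ H)) :
    V.pairing x ⟨sliceSnd ρ V.op, ρ, rfl⟩ = ρ x := by
  conv_rhs => rw [← V.exists_sliceFst_section.choose_spec x, apply_sliceFst_eq]
  rfl

theorem pairing_slice_slice (ω ρ : Module.Dual ℂ (Module.End ℂ H)) :
    V.pairing ⟨sliceFst ω V.op, ω, rfl⟩ ⟨sliceSnd ρ V.op, ρ, rfl⟩ = ρ (sliceFst ω V.op) :=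
  V.pairing_slice _ ρ

theorem pairing_flip_bijective : Function.Bijective V.pairing.flip := by
  constructor
  · rw [← LinearMap.ker_eq_bot, LinearMap.ker_eq_bot']
    rintro ⟨y, ρ, rfl⟩ h
    apply Subtype.ext
    refine (Module.forall_dual_apply_eq_zero_iff ℂ _).mp fun ω => ?_
    have h' := LinearMap.congr_fun h ⟨sliceFst ω V.op, ω, rfl⟩
    rw [LinearMap.flip_apply, pairing_slice_slice, apply_sliceFst_eq] at h'
    exact h'
  · intro f
    obtain ⟨ρ, hρ⟩ := LinearMap.exists_extend
      (p := Subalgebra.toSubmodule V.S.toSubalgebra) f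
    refine ⟨⟨sliceSnd ρ V.op, ρ, rfl⟩, LinearMap.ext fun x => ?_⟩
    rw [LinearMap.flip_apply, pairing_slice]
    exact LinearMap.congr_fun hρ x

/-- The identification of `Ŝ` with the dual space of `S`, `y ↦ β(·, y)`. -/
def dualEquiv : V.dualS ≃ₗ[ℂ] Module.Dual ℂ V.S :=
  LinearEquiv.ofBijective V.pairing.flip V.pairing_flip_bijective

/-- The action on the dual `Ŝ` of an automorphism `α` of `S`: the transpose of `α`. -/
def dualAction (α : V.S ≃⋆ₐ[ℂ] V.S) : V.dualS →ₗ[ℂ] V.dualS :=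
  V.dualEquiv.symm.toLinearMap ∘ₗ Module.Dual.transpose (α : V.S →ₗ[ℂ] V.S) ∘ₗ
    V.dualEquiv.toLinearMap

/-- The defining property of the dual action: `β(x, α̂(y)) = β(α(x), y)`. -/
theorem pairing_dualAction (α : V.S ≃⋆ₐ[ℂ] V.S) (x : V.S) (y : V.dualS) :
    V.pairing x (V.dualAction α y) = V.pairing (α x) y :=
  LinearMap.congr_fun (V.dualEquiv.apply_symm_apply
    (Module.Dual.transpose (α : V.S →ₗ[ℂ] V.S) (V.dualEquiv y))) x

end MultiplicativeUnitary

/-- A self-map of an algebra is inner if it is conjugation by an invertible element. -/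
def IsInnerMap {A : Type*} [Monoid A] (φ : A → A) : Prop :=
  ∃ g : Aˣ, ∀ y, φ y = g * y * ↑g⁻¹

end

/-! Taking slices of `V` turns `α̂ = Ad g` into `(1 ⊗ u) V (1 ⊗ u*) = (g ⊗ 1) V (g⁻¹ ⊗ 1)`, that is,
`g⁻¹ ⊗ u` commutes with `V`. Write `h = g⁻¹`. As `V` is unitary, its commutant is a star algebra, so
it also contains `(h ⊗ u)* (h ⊗ u) = h* h ⊗ 1`, hence `|h|⁻¹ ⊗ 1`, and the unitary part `h |h|⁻¹` of
the polar decomposition of `h`, which stays in `Ŝ`, can replace `h`. -/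

theorem commute_star_of_mem_unitary {A : Type*} [Monoid A] [StarMul A] {a v : A}
    (hv : v ∈ unitary A) (h : Commute a v) : Commute a (star v) :=
  Commute.units_inv_right (u := Unitary.toUnits ⟨v, hv⟩) h

section CStarAlgebra

variable {A : Type*} [CStarAlgebra A] [PartialOrder A] [StarOrderedRing A]

theorem mul_rpow_neg_half_mem_unitary {a : A} (ha : IsUnit a) :
    a * (star a * a) ^ (-(1 / 2) : ℝ) ∈ unitary A := by
  have hpos : IsStrictlyPositive (star a * a) :=
    CStarAlgebra.isStrictlyPositive_iff_eq_star_mul_self.2 ⟨a, ha, rfl⟩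
  have hr : star ((star a * a) ^ (-(1 / 2) : ℝ)) = (star a * a) ^ (-(1 / 2) : ℝ) :=
    (IsSelfAdjoint.of_nonneg CFC.rpow_nonneg).star_eq
  have hunit : IsUnit (a * (star a * a) ^ (-(1 / 2) : ℝ)) :=
    ha.mul (IsStrictlyPositive.rpow _ _ hpos).isUnit
  refine hunit.mem_unitary_of_star_mul_self ?_
  rw [star_mul, hr, mul_assoc, ← mul_assoc (star a), ← mul_assoc]
  exact CFC.conjugate_rpow_neg_one_half (star a * a)

theorem rpow_mem_of_isClosed (S : StarSubalgebra ℂ A) (hS : IsClosed (S : Set A)) {a : A}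
    (ha : 0 ≤ a) (haS : a ∈ S) (t : ℝ) : a ^ t ∈ S := by
  rw [CFC.rpow_eq_cfc_real]
  exact cfc_mem (𝕜 := ℝ) (𝕜' := ℂ) (hs := hS) _ haS

end CStarAlgebra

section FiniteDimensional

variable {E F : Type*} [NormedAddCommGroup E] [InnerProductSpace ℂ E] [FiniteDimensional ℂ E]
  [NormedAddCommGroup F] [InnerProductSpace ℂ F] [FiniteDimensional ℂ F]

variable (E) in
/-- The star algebra isomorphism between linear and bounded operators on a finite-dimensional inner
product space. It carries the C⋆-norm and the Loewner order, hence the continuous functional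
calculus, over to `Module.End ℂ E`, which has no norm of its own. -/
noncomputable def endStarAlgEquivCLM : Module.End ℂ E ≃⋆ₐ[ℂ] (E →L[ℂ] E) :=
  StarAlgEquiv.ofAlgEquiv (Module.End.toContinuousLinearMap E)
    LinearMap.adjoint_toContinuousLinearMap

theorem exists_mem_mul_mem_unitary (S : StarSubalgebra ℂ (Module.End ℂ E)) {h : Module.End ℂ E}
    (hh : IsUnit h) (hS : star h * h ∈ S) : ∃ r ∈ S, h * r ∈ unitary (Module.End ℂ E) := by
  let e := endStarAlgEquivCLM E
  let S' : StarSubalgebra ℂ (E →L[ℂ] E) := S.comap (e.symm : (E →L[ℂ] E) →⋆ₐ[ℂ] Module.End ℂ E)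
  have hclosed : IsClosed (S' : Set (E →L[ℂ] E)) :=
    Submodule.closed_of_finiteDimensional (Subalgebra.toSubmodule S'.toSubalgebra)
  have hmem : star (e h) * e h ∈ S' := by
    rw [← map_star, ← map_mul]
    simpa [S', StarSubalgebra.mem_comap] using hS
  refine ⟨e.symm ((star (e h) * e h) ^ (-(1 / 2) : ℝ)),
    rpow_mem_of_isClosed S' hclosed (star_mul_self_nonneg _) hmem _, ?_⟩
  have hunitary := Unitary.map_mem e.symm (mul_rpow_neg_half_mem_unitary (hh.map e))
  rwa [map_mul, e.symm_apply_apply] at hunitary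

variable (E F) in
/-- The amplification `a ↦ a ⊗ 1` from operators on `E` to operators on `E ⊗ F`, as a star algebra
homomorphism. -/
noncomputable def endRTensorStarAlgHom : Module.End ℂ E →⋆ₐ[ℂ] Module.End ℂ (E ⊗[ℂ] F) where
  __ := Module.End.rTensorAlgHom ℂ E F
  map_star' a := (LinearMap.adjoint_rTensor a).symm

theorem exists_unitary_mem_map_mem (A : StarSubalgebra ℂ (Module.End ℂ E))
    (C : StarSubalgebra ℂ (Module.End ℂ (E ⊗[ℂ] F))) {h : Module.End ℂ E} {u : Module.End ℂ F}
    (hh : IsUnit h) (hA : h ∈ A) (hu : star u * u = 1) (hC : TensorProduct.map h u ∈ C) :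
    ∃ v ∈ unitary (Module.End ℂ E), v ∈ A ∧ TensorProduct.map v u ∈ C := by
  have hmod : TensorProduct.map (star h * h) (1 : Module.End ℂ F) ∈ C := by
    rw [← hu, TensorProduct.map_mul, ← star_map_tensor]
    exact mul_mem (star_mem hC) hC
  have hmem : star h * h ∈ A ⊓ C.comap (endRTensorStarAlgHom E F) :=
    ⟨mul_mem (star_mem hA) hA, hmod⟩
  obtain ⟨r, ⟨hrA, hrC⟩, hunitary⟩ := exists_mem_mul_mem_unitary _ hh hmem
  have hmap : TensorProduct.map (h * r) u = TensorProduct.map h u * TensorProduct.map r 1 := by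
    rw [← TensorProduct.map_mul, mul_one]
  exact ⟨h * r, hunitary, mul_mem hA hrA, hmap ▸ mul_mem hC hrC⟩

theorem exists_unitary_mem_commute_map (A : StarSubalgebra ℂ (Module.End ℂ E))
    {X : Module.End ℂ (E ⊗[ℂ] F)} (hX : X ∈ unitary (Module.End ℂ (E ⊗[ℂ] F)))
    {h : Module.End ℂ E} {u : Module.End ℂ F} (hh : IsUnit h) (hA : h ∈ A) (hu : star u * u = 1)
    (hcomm : Commute (TensorProduct.map h u) X) :
    ∃ v ∈ unitary (Module.End ℂ E), v ∈ A ∧ Commute (TensorProduct.map v u) X := by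
  have hcentralizer (W : Module.End ℂ (E ⊗[ℂ] F)) :
      W ∈ StarSubalgebra.centralizer ℂ {X} ↔ Commute W X := by
    simp only [StarSubalgebra.mem_centralizer_iff, Set.mem_singleton_iff, forall_eq]
    exact ⟨fun h => h.1.symm, fun h => ⟨h.eq.symm, (commute_star_of_mem_unitary hX h).eq.symm⟩⟩
  simp only [← hcentralizer] at hcomm ⊢
  exact exists_unitary_mem_map_mem A _ hh hA hu hcomm

end FiniteDimensional

section SliceProducts

variable {E F : Type*} [AddCommGroup E] [Module ℂ E] [FiniteDimensional ℂ E]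
  [AddCommGroup F] [Module ℂ F] [FiniteDimensional ℂ F]

theorem ext_sliceSnd {X Y : Module.End ℂ (E ⊗[ℂ] F)} (h : ∀ ρ, sliceSnd ρ X = sliceSnd ρ Y) :
    X = Y := by
  rw [eq_sum_map_sliceSnd (Module.finBasis ℂ (Module.End ℂ F)) X,
    eq_sum_map_sliceSnd (Module.finBasis ℂ (Module.End ℂ F)) Y]
  simp only [h]

theorem sliceSnd_map_mul (ρ : Module.Dual ℂ (Module.End ℂ F)) (a : Module.End ℂ E)
    (b : Module.End ℂ F) (X : Module.End ℂ (E ⊗[ℂ] F)) :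
    sliceSnd ρ (TensorProduct.map a b * X) = a * sliceSnd (ρ ∘ₗ LinearMap.mulLeft ℂ b) X := by
  induction X using endTensor_induction with
  | h0 => simp
  | hm x y => simp [← TensorProduct.map_mul, sliceSnd_map]
  | ha X Y hX hY => simp [mul_add, hX, hY]

theorem sliceSnd_mul_map (ρ : Module.Dual ℂ (Module.End ℂ F)) (a : Module.End ℂ E)
    (b : Module.End ℂ F) (X : Module.End ℂ (E ⊗[ℂ] F)) :
    sliceSnd ρ (X * TensorProduct.map a b) = sliceSnd (ρ ∘ₗ LinearMap.mulRight ℂ b) X * a := by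
  induction X using endTensor_induction with
  | h0 => simp
  | hm x y => simp [← TensorProduct.map_mul, sliceSnd_map]
  | ha X Y hX hY => simp [add_mul, hX, hY]

end SliceProducts

namespace MultiplicativeUnitary

variable {H : Type*} [NormedAddCommGroup H] [InnerProductSpace ℂ H] [FiniteDimensional ℂ H]
  (V : MultiplicativeUnitary H) {u u' : Module.End ℂ H} {α : V.S ≃⋆ₐ[ℂ] V.S}

theorem dualAction_sliceSnd
    (hα : ∀ x : V.S, (α x : Module.End ℂ H) = u * (x : Module.End ℂ H) * u')
    (ρ : Module.Dual ℂ (Module.End ℂ H)) :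
    V.dualAction α ⟨sliceSnd ρ V.op, ρ, rfl⟩ =
      ⟨sliceSnd (ρ ∘ₗ LinearMap.mulLeft ℂ u ∘ₗ LinearMap.mulRight ℂ u') V.op, _, rfl⟩ := by
  refine V.pairing_flip_bijective.1 (LinearMap.ext fun x => ?_)
  simp only [LinearMap.flip_apply, pairing_dualAction, pairing_slice, hα, LinearMap.comp_apply,
    LinearMap.mulLeft_apply, LinearMap.mulRight_apply, mul_assoc]

theorem commute_map_inv_op (hu : u' * u = 1)
    (hα : ∀ x : V.S, (α x : Module.End ℂ H) = u * (x : Module.End ℂ H) * u')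
    (g : V.dualSˣ) (hg : ∀ y, V.dualAction α y = g * y * ↑g⁻¹) :
    Commute (TensorProduct.map ((↑g⁻¹ : V.dualS) : Module.End ℂ H) u) V.op := by
  refine ext_sliceSnd fun ρ => ?_
  let y : V.dualS := ⟨sliceSnd (ρ ∘ₗ LinearMap.mulRight ℂ u) V.op, _, rfl⟩
  have hy : (V.dualAction α y : Module.End ℂ H) =
      sliceSnd (ρ ∘ₗ LinearMap.mulLeft ℂ u) V.op := by
    rw [V.dualAction_sliceSnd hα]
    refine congrArg (sliceSnd · V.op) (LinearMap.ext fun x => ?_)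
    simp [mul_assoc, hu]
  have hconj : ↑g⁻¹ * V.dualAction α y = y * ↑g⁻¹ := by
    rw [hg, mul_assoc, Units.inv_mul_cancel_left]
  rw [sliceSnd_map_mul, sliceSnd_mul_map, ← hy]
  exact congrArg Subtype.val hconj

end MultiplicativeUnitary

theorem mainTheorem2 {H : Type*} [NormedAddCommGroup H] [InnerProductSpace ℂ H]
    [FiniteDimensional ℂ H] (V : MultiplicativeUnitary H)
    (u : Module.End ℂ H) (hu : u ∈ unitary (Module.End ℂ H))
    (α : V.S ≃⋆ₐ[ℂ] V.S)
    (hαu : ∀ x : V.S, (α x : Module.End ℂ H) = u * (x : Module.End ℂ H) * star u)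
    (hα : V.IsHopfAut α) (hinner : IsInnerMap (V.dualAction α)) :
    ∃ v : Module.End ℂ H, v ∈ unitary (Module.End ℂ H) ∧ v ∈ V.dualS ∧
      Commute (TensorProduct.map v u : Module.End ℂ (H ⊗[ℂ] H)) V.op := by
  obtain ⟨g, hg⟩ := hinner
  have hinv : IsUnit ((↑g⁻¹ : V.dualS) : Module.End ℂ H) := g⁻¹.isUnit.map V.dualS.subtype
  have hu' : star u * u = 1 := Unitary.star_mul_self_of_mem hu
  exact exists_unitary_mem_commute_map V.dualS V.mem_unitary hinv (↑g⁻¹ : V.dualS).2 hu'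
    (V.commute_map_inv_op hu' hαu g hg)
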